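/- Let $0<\lambda_1<\lambda_2<\cdots$ be real numbers with $\lambda_n\to+\infty$, and let $a_n\in\mathbb C$ (possibly all but finitely many zero) be such that $\sum_{n\ge1}|a_n|e^{-\lambda_n\bar\sigma}<\infty$ for some $\bar\sigma\in\mathbb R$. Suppose that the Dirichlet series $$1+\sum_{n\ge 1}a_n e^{-\lambda_n s},\qquad \Re s>\bar\sigma,$$ is non-constant and extends to a meromorphic function $f$ of finite order on $\mathbb C$ (that is, its Nevanlinna characteristic satisfies $T(r,f)=O(r^k)$ as $r\to\infty$ for some $k\in\mathbb N$). Then the divisor of $f$ is not contained in a left cone: for all $\alpha\in\mathbb C$ and all real $\theta_1,\theta_2$ with $\pi/2<\theta_1<\theta_2<3\pi/2$, the set of zeros and poles of $f$ is not contained in $$\alpha+C(\theta_1,\theta_2),\qquad C(\theta_1,\theta_2)=\{re^{i\theta}: r>0,\ \theta_1<\theta<\theta_2\}.$$ -/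

import Mathlib

open Filter

/-- The open cone `C(θ₁, θ₂)` of all `r * exp (i θ)` with `r > 0` and `θ₁ < θ < θ₂`
(so the argument is not restricted to the principal branch). -/
def openCone (θ₁ θ₂ : ℝ) : Set ℂ :=
  {z | ∃ r θ : ℝ, 0 < r ∧ θ₁ < θ ∧ θ < θ₂ ∧ z = (r : ℂ) * Complex.exp ((θ : ℂ) * Complex.I)}

/-- A function on the plane has finite order if its Nevanlinna characteristic `T(r, f)` grows at
most polynomially in `r`. -/
def HasFiniteOrder (f : ℂ → ℂ) : Prop :=
  ∃ k : ℕ, (ValueDistribution.characteristic f ⊤) =O[atTop] (fun r : ℝ => r ^ k)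

/-- `f` is a meromorphic function of finite order on the plane which on some right half plane of
absolute convergence is given by a non-constant Dirichlet series
`1 + ∑ aₙ exp (-λₙ s)`, where `0 < λ₀ < λ₁ < ⋯` and `λₙ → ∞`. Finite sets of exponents are
included, by letting all but finitely many `aₙ` vanish. -/
def IsMeromorphicDirichletSeries (f : ℂ → ℂ) : Prop :=
  Meromorphic f ∧ HasFiniteOrder f ∧
  ∃ (a : ℕ → ℂ) (l : ℕ → ℝ) (σ : ℝ),
    0 < l 0 ∧ StrictMono l ∧ Tendsto l atTop atTop ∧
    Summable (fun n => ‖a n‖ * Real.exp (-(l n * σ))) ∧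
    (∀ s : ℂ, σ < s.re → f s = 1 + ∑' n, a n * Complex.exp (-((l n : ℂ) * s))) ∧
    (∃ s s' : ℂ, σ < s.re ∧ σ < s'.re ∧ f s ≠ f s')

/-! Suppose the divisor lies in a left cone with apex `α`. Its complement is a sector of opening
larger than `π`, so it contains the image of the right half plane under `ψ w = β + (K + w) log (K +
w)`: the logarithm bends the half plane by an angle that tends to zero. Hence `G = f ∘ ψ` (with
removable values corrected) is holomorphic and zero-free there. On the real axis `G - 1` is `O(exp
(-λ₀ x log x))`, faster than any exponential, while finite order bounds `log ‖G‖` polynomially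
(`log_norm_le_of_proximity_le`). Borel–Carathéodory turns this into a polynomial bound for `H = log
G`, and Phragmén–Lindelöf forces `H = 0` (`eq_one_of_superexponential_decay`). So `f = 1` on an open
set, against non-constancy. -/

/-! ### Pointwise bounds from the proximity function -/

open MeasureTheory Metric Real in
/-- Integration in polar coordinates around an arbitrary centre. -/
theorem lintegral_eq_lintegral_circleMap {φ : ℂ → ENNReal} (hφ : Measurable φ) (c : ℂ) :
    ∫⁻ w, φ w = ∫⁻ r in Set.Ioi (0 : ℝ), ENNReal.ofReal r *
      ∫⁻ θ in Set.Ioo (-π) π, φ (circleMap c r θ) := by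
  have hmap : Measurable fun p : ℝ × ℝ => φ (circleMap c p.1 p.2) := by
    refine hφ.comp ?_
    simp only [circleMap]
    fun_prop
  calc ∫⁻ w, φ w = ∫⁻ w, φ (c + w) := (lintegral_add_left_eq_self φ c).symm
    _ = ∫⁻ p in polarCoord.target, ENNReal.ofReal p.1 * φ (circleMap c p.1 p.2) := by
      rw [← Complex.lintegral_comp_polarCoord_symm]
      refine lintegral_congr fun p => ?_
      simp [circleMap, Complex.exp_mul_I]
    _ = _ := by
      rw [polarCoord_target, Measure.volume_eq_prod, ← Measure.prod_restrict, lintegral_prod]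
      · exact lintegral_congr fun r => lintegral_const_mul (ENNReal.ofReal r)
          (f := fun θ => φ (circleMap c r θ)) (hmap.comp measurable_prodMk_left)
      · exact (Measurable.mul (by fun_prop) hmap).aemeasurable

open MeasureTheory Metric Real in
/-- The integral of a nonnegative function over a circle, in terms of its average. -/
theorem lintegral_circleMap_eq_circleAverage {u : ℂ → ℝ} (hu : ∀ w, 0 ≤ u w) {c : ℂ} {r : ℝ}
    (hint : CircleIntegrable u c r) :
    ∫⁻ θ in Set.Ioo (-π) π, ENNReal.ofReal (u (circleMap c r θ)) =
      ENNReal.ofReal (2 * π * circleAverage u c r) := by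
  have hper : Function.Periodic (fun θ => u (circleMap c r θ)) (2 * π) := fun θ => by
    simp [periodic_circleMap c r θ]
  have hle : -π ≤ π := by linarith [pi_pos]
  have hint' : IntervalIntegrable (fun θ => u (circleMap c r θ)) volume (-π) π :=
    hper.intervalIntegrable₀ (by positivity) hint _ _
  have havg : 2 * π * circleAverage u c r = ∫ θ in Set.Ioo (-π) π, u (circleMap c r θ) := by
    have h := hper.intervalIntegral_add_eq 0 (-π)
    rw [zero_add, show -π + 2 * π = π by ring] at h
    rw [circleAverage, smul_eq_mul, h, intervalIntegral.integral_of_le hle,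
      integral_Ioc_eq_integral_Ioo]
    field_simp
  rw [havg, ofReal_integral_eq_lintegral_ofReal]
  · exact (hint'.1.mono_set Set.Ioo_subset_Ioc_self)
  · exact Eventually.of_forall fun θ => hu _

open MeasureTheory Metric Real ValueDistribution in
/-- Where a meromorphic function has no zeros and no poles in a disc, its size at the centre is
controlled by the proximity function at nearby radii. -/
theorem log_norm_le_of_proximity_le {g : ℂ → ℂ} (hg : Meromorphic g) {z : ℂ} {M : ℝ}
    (hz : 1 ≤ ‖z‖) (hana : AnalyticOnNhd ℂ g (ball z 1)) (hne : ∀ w ∈ ball z 1, g w ≠ 0)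
    (hprox : ∀ r, ‖z‖ - 1 < r → r < ‖z‖ + 1 → proximity g ⊤ r ≤ M) :
    log ‖g z‖ ≤ 8 * (‖z‖ + 1) * M := by
  set u : ℂ → ℝ := fun w => log⁺ ‖g w‖ with hu
  have hu0 : ∀ w, 0 ≤ u w := fun w => posLog_nonneg
  have hum : Measurable u := by
    have : Measurable g := hg.measurable
    simp only [hu, posLog_def]
    fun_prop
  have hci : ∀ c r, CircleIntegrable u c r := fun c r =>
    MeromorphicOn.circleIntegrable_posLog_norm fun w _ => hg w
  have hM : 0 ≤ M := (proximity_nonneg _).trans (hprox ‖z‖ (by linarith) (by linarith))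
  set φ : ℂ → ENNReal := fun w => ENNReal.ofReal (u w) with hφ
  have hφm : Measurable φ := hum.ennreal_ofReal
  -- `log ‖g‖` is harmonic on the disc, so its circle means equal `log ‖g z‖`. Radii in `(1/2, 1)`,
  -- with `r ≥ 1/2`, give `1/2 * 1/2 * 2π = π/2`.
  have hlower : ENNReal.ofReal (π / 2 * log ‖g z‖) ≤ ∫⁻ w, (ball z 1).indicator φ w := by
    rw [lintegral_eq_lintegral_circleMap (hφm.indicator measurableSet_ball) z]
    have hsub : Set.Ioo (1 / 2 : ℝ) 1 ⊆ Set.Ioi 0 := fun r hr => by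
      simp only [Set.mem_Ioo, Set.mem_Ioi] at hr ⊢; linarith
    refine le_trans ?_ (lintegral_mono_set hsub)
    have hconst : ENNReal.ofReal (π / 2 * log ‖g z‖) = ∫⁻ _ in Set.Ioo (1 / 2 : ℝ) 1,
        ENNReal.ofReal (1 / 2) * ENNReal.ofReal (2 * π * log ‖g z‖) := by
      rw [lintegral_const, Measure.restrict_apply_univ, Real.volume_Ioo,
        ← ENNReal.ofReal_mul (by norm_num), ← ENNReal.ofReal_mul' (by norm_num)]
      congr 1; ring
    rw [hconst]
    refine setLIntegral_mono' measurableSet_Ioo fun r hr => ?_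
    have hr0 : 0 < r := hsub hr
    have hball : closedBall z |r| ⊆ ball z 1 := by
      rw [abs_of_pos hr0]; exact closedBall_subset_ball hr.2
    gcongr
    · exact hr.1.le
    have hind : ∀ θ, (ball z 1).indicator φ (circleMap z r θ) = ENNReal.ofReal (u (circleMap z r θ)) :=
      fun θ =>
      Set.indicator_of_mem (hball (sphere_subset_closedBall (circleMap_mem_sphere' z r θ))) _
    simp only [hind]
    rw [lintegral_circleMap_eq_circleAverage hu0 (hci z r)]
    gcongr
    rw [← AnalyticOnNhd.circleAverage_log_norm_of_ne_zero (hana.mono hball)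
      fun w hw => hne w (hball hw)]
    exact circleAverage_mono (MeromorphicOn.circleIntegrable_log_norm fun w _ => hg w) (hci z r)
      fun w _ => le_max_right _ _
  -- The disc lies in an annulus of width 2 about the origin, whose circles each contribute at most
  -- `(‖z‖ + 1) * 2πM`.
  have hupper : ∫⁻ w, (ball z 1).indicator φ w ≤
      ENNReal.ofReal (4 * π * (‖z‖ + 1) * M) := by
    set S : Set ℝ := Set.Ioo (‖z‖ - 1) (‖z‖ + 1) with hS
    set T : Set ℂ := {w | ‖w‖ ∈ S} with hT
    have hTm : MeasurableSet T := measurable_norm measurableSet_Ioo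
    have hle : ∫⁻ w, (ball z 1).indicator φ w ≤ ∫⁻ w, T.indicator φ w := by
      refine lintegral_mono (Set.indicator_le_indicator_of_subset (fun w hw => ?_) fun _ => zero_le)
      rw [mem_ball, dist_eq_norm] at hw
      have h1 := norm_sub_norm_le w z
      have h2 := norm_sub_norm_le z w
      rw [norm_sub_rev] at h2
      simp only [hT, hS, Set.mem_ofPred_eq, Set.mem_Ioo]
      constructor <;> linarith
    refine hle.trans ?_
    rw [lintegral_eq_lintegral_circleMap (hφm.indicator hTm) 0]
    calc _ ≤ ∫⁻ r in Set.Ioi (0 : ℝ), S.indicator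
          (fun _ => ENNReal.ofReal (‖z‖ + 1) * ENNReal.ofReal (2 * π * M)) r := by
          refine setLIntegral_mono' measurableSet_Ioi fun r hr => ?_
          have hr0 : 0 < r := hr
          have hnorm : ∀ θ, ‖circleMap 0 r θ‖ = r := fun θ => by simp [abs_of_pos hr0]
          by_cases hrS : r ∈ S
          · have hind : ∀ θ, T.indicator φ (circleMap 0 r θ) = ENNReal.ofReal (u (circleMap 0 r θ)) :=
              fun θ =>
              Set.indicator_of_mem (s := T) (show ‖circleMap 0 r θ‖ ∈ S by rwa [hnorm]) _
            rw [Set.indicator_of_mem hrS]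
            simp only [hind]
            rw [lintegral_circleMap_eq_circleAverage hu0 (hci 0 r)]
            have := hprox r hrS.1 hrS.2
            rw [proximity_top] at this
            gcongr
            exact hrS.2.le
          · have hind : ∀ θ, T.indicator φ (circleMap 0 r θ) = 0 := fun θ =>
              Set.indicator_of_notMem (s := T) (show ¬ ‖circleMap 0 r θ‖ ∈ S by rwa [hnorm]) _
            simp [hind]
      _ ≤ ∫⁻ r, S.indicator
          (fun _ => ENNReal.ofReal (‖z‖ + 1) * ENNReal.ofReal (2 * π * M)) r :=
          setLIntegral_le_lintegral _ _
      _ = _ := by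
          rw [lintegral_indicator measurableSet_Ioo, lintegral_const,
            Measure.restrict_apply_univ, Real.volume_Ioo, ← ENNReal.ofReal_mul (by positivity),
            ← ENNReal.ofReal_mul (by positivity)]
          congr 1; ring
  have := (ENNReal.ofReal_le_ofReal_iff (by positivity)).1 (hlower.trans hupper)
  have h3 : π / 2 * log ‖g z‖ ≤ π / 2 * (8 * (‖z‖ + 1) * M) := by linarith
  exact le_of_mul_le_mul_left h3 (by positivity)

/-! ### Holomorphic logarithms on the half plane -/

/-- A nonvanishing holomorphic function on the right half plane has a holomorphic logarithm. -/
theorem exists_log_of_ne_zero_of_re_pos {G : ℂ → ℂ} (hG : DifferentiableOn ℂ G {w | 0 < w.re})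
    (hne : ∀ w : ℂ, 0 < w.re → G w ≠ 0) :
    ∃ H : ℂ → ℂ, DifferentiableOn ℂ H {w | 0 < w.re} ∧
      ∀ w : ℂ, 0 < w.re → Complex.exp (H w) = G w := by
  have hopen : IsOpen {w : ℂ | 0 < w.re} := isOpen_lt continuous_const Complex.continuous_re
  have hsc : IsSimplyConnected {w : ℂ | 0 < w.re} :=
    have := (convex_halfSpace_re_gt 0).contractibleSpace ⟨1, by simp⟩
    SimplyConnectedSpace.ofContractible _
  obtain ⟨H, hHc, hHe⟩ := Complex.exists_continuousOn_eqOn_exp_comp hsc hopen hG.continuousOn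
    (by rintro ⟨w, hw, h⟩; exact hne w hw h)
  refine ⟨H, fun w hw => ?_, fun w hw => hHe hw⟩
  have hHat : ContinuousAt H w := hHc.continuousAt (hopen.mem_nhds hw)
  have hGat : DifferentiableAt ℂ G w := hG.differentiableAt (hopen.mem_nhds hw)
  -- A continuous logarithm is locally a constant plus a principal one, hence holomorphic.
  have hev : ∀ᶠ v in nhds w, H v = H w + Complex.log (G v / G w) := by
    have him : ∀ᶠ v in nhds w, |(H v - H w).im| < Real.pi := by
      have : ContinuousAt (fun v => |(H v - H w).im|) w := by fun_prop
      exact this.eventually_lt continuousAt_const (by simp [Real.pi_pos])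
    filter_upwards [him, hopen.mem_nhds hw] with v hv hvU
    have h1 : G v / G w = Complex.exp (H v - H w) := by
      rw [Complex.exp_sub]
      exact congrArg₂ (· / ·) (hHe hvU).symm (hHe hw).symm
    rw [h1, Complex.log_exp (by linarith [neg_abs_le (H v - H w).im])
      (le_trans (le_abs_self _) hv.le)]
    ring
  refine DifferentiableAt.differentiableWithinAt ?_
  refine DifferentiableAt.congr_of_eventuallyEq ?_ hev
  refine (differentiableAt_const _).add ((hGat.div_const _).clog ?_)
  rw [div_self (hne w hw)]
  exact Complex.one_mem_slitPlane

/-- The holomorphic logarithm of a function close to `1` far out on the real axis can be chosen to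
be the principal branch there. -/
theorem exists_log_eq_principal_of_re_pos {G : ℂ → ℂ}
    (hG : DifferentiableOn ℂ G {w | 0 < w.re}) (hne : ∀ w : ℂ, 0 < w.re → G w ≠ 0)
    {x₀ : ℝ} (hx₀ : 0 < x₀) (hclose : ∀ x : ℝ, x₀ < x → G x ∈ Complex.slitPlane) :
    ∃ H : ℂ → ℂ, DifferentiableOn ℂ H {w | 0 < w.re} ∧
      (∀ w : ℂ, 0 < w.re → Complex.exp (H w) = G w) ∧
      ∀ x : ℝ, x₀ < x → H x = Complex.log (G x) := by
  obtain ⟨H, hHd, hHe⟩ := exists_log_of_ne_zero_of_re_pos hG hne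
  have hopen : IsOpen {w : ℂ | 0 < w.re} := isOpen_lt continuous_const Complex.continuous_re
  have hpos : ∀ x : ℝ, x₀ < x → 0 < (x : ℂ).re := fun x hx => by simpa using hx₀.trans hx
  have hderiv : ∀ x ∈ Set.Ioi x₀,
      HasDerivAt (fun x : ℝ => H x - Complex.log (G x)) 0 x := by
    intro x hx
    have hmem := hopen.mem_nhds (hpos x hx)
    have hHx := (hHd.differentiableAt hmem).hasDerivAt
    have hexp : HasDerivAt G (Complex.exp (H x) * deriv H x) (x : ℂ) :=
      hHx.cexp.congr_of_eventuallyEq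
        (by filter_upwards [hmem] with v hv using (hHe v hv).symm)
    have h := (hHx.sub (hexp.clog (hclose x hx))).comp_ofReal
    convert! h using 1
    rw [hHe _ (hpos x hx)]
    field_simp [hne _ (hpos x hx)]
    ring
  obtain ⟨k, hk⟩ := isOpen_Ioi.exists_is_const_of_deriv_eq_zero (convex_Ioi x₀).isPreconnected
    (fun x hx => (hderiv x hx).differentiableAt.differentiableWithinAt)
    (fun x hx => (hderiv x hx).deriv)
  have hexpk : Complex.exp k = 1 := by
    have hx : x₀ < x₀ + 1 := by linarith
    rw [← hk _ hx, Complex.exp_sub, hHe _ (hpos _ hx), Complex.exp_log (hne _ (hpos _ hx)),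
      div_self (hne _ (hpos _ hx))]
  refine ⟨fun w => H w - k, hHd.sub_const k, fun w hw => ?_, fun x hx => ?_⟩
  · rw [Complex.exp_sub, hexpk, div_one, hHe w hw]
  · rw [← hk x hx]; ring

/-! ### Growth and uniqueness on the half plane -/

/-- A holomorphic function on the right half plane whose real part has polynomial growth, and which
is bounded far out on the real axis, has polynomial growth away from the boundary. -/
theorem norm_le_pow_of_re_le_pow {H : ℂ → ℂ} (hH : DifferentiableOn ℂ H {w | 0 < w.re})
    {C B x₀ : ℝ} {m : ℕ} (hC : 0 < C) (hB : 0 ≤ B) (hx₀ : 0 ≤ x₀)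
    (hre : ∀ w : ℂ, 0 < w.re → (H w).re ≤ C * (1 + ‖w‖) ^ m)
    (hreal : ∀ x : ℝ, x₀ < x → ‖H x‖ ≤ B) :
    ∃ C' : ℝ, ∀ w : ℂ, 1 ≤ w.re → ‖H w‖ ≤ C' * (1 + ‖w‖) ^ (2 * m + 2) := by
  refine ⟨4 * (x₀ + 1) * (C * (2 * x₀ + 3) ^ m + B), fun w hw => ?_⟩
  have hw1 : 1 ≤ ‖w‖ := hw.trans (Complex.re_le_norm w)
  -- The disc with centre and radius `R` touches the imaginary axis at 0. Since `w.re ≥ 1` and `‖w‖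
  -- ^ 2 ≤ R`, the point `w` stays `1/2` inside it. The quadratic size of `R` doubles the exponent.
  set R : ℝ := x₀ + ‖w‖ ^ 2 with hR
  have hR1 : 1 ≤ R := by nlinarith
  set M : ℝ := C * (1 + 2 * R) ^ m with hM
  have hM0 : 0 < M := by positivity
  have hball : ∀ v ∈ Metric.ball (0 : ℂ) R, 0 < ((R : ℂ) + v).re ∧ ‖(R : ℂ) + v‖ ≤ 2 * R := by
    intro v hv
    rw [mem_ball_zero_iff] at hv
    have := (abs_le.1 (Complex.abs_re_le_norm v)).1
    refine ⟨by simp; linarith, (norm_add_le _ _).trans ?_⟩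
    rw [Complex.norm_real, Real.norm_of_nonneg (by linarith)]
    linarith
  have hz : ‖w - R‖ ≤ R - 1 / 2 := by
    refine abs_le_of_sq_le_sq' ?_ (by linarith) |>.2
    rw [← Complex.normSq_eq_norm_sq, Complex.normSq_apply]
    have h2 : ‖w‖ ^ 2 = w.re * w.re + w.im * w.im := by
      rw [← Complex.normSq_eq_norm_sq, Complex.normSq_apply]
    simp only [Complex.sub_re, Complex.ofReal_re, Complex.sub_im, Complex.ofReal_im, sub_zero]
    nlinarith
  have hbc := Complex.borelCaratheodory (f := fun v => H (R + v)) (R := R) (z := w - R) hM0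
    (hH.comp (by fun_prop) fun v hv => (hball v hv).1)
    (fun v hv => (hre _ (hball v hv).1).trans (by
      rw [hM]; gcongr; exact (hball v hv).2))
    (by linarith) (by rw [mem_ball_zero_iff]; linarith)
  simp only [add_sub_cancel, add_zero] at hbc
  have hHR : ‖H R‖ ≤ B := hreal R (by nlinarith)
  set P := 1 + ‖w‖ with hP
  have hP1 : 1 ≤ P := by linarith
  have hRP : R ≤ (x₀ + 1) * P ^ 2 := by nlinarith [mul_nonneg hx₀ (norm_nonneg w)]
  have hRP' : 1 + 2 * R ≤ (2 * x₀ + 3) * P ^ 2 := by nlinarith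
  have hMP : M ≤ C * (2 * x₀ + 3) ^ m * P ^ (2 * m) := by
    rw [hM, mul_assoc, pow_mul, ← mul_pow]
    gcongr
  have hBP : B ≤ B * P ^ (2 * m) := le_mul_of_one_le_right hB (one_le_pow₀ hP1)
  calc ‖H w‖ ≤ 2 * M * ‖w - R‖ / (R - ‖w - R‖) + ‖H R‖ * (R + ‖w - R‖) / (R - ‖w - R‖) := hbc
    _ ≤ 2 * M * R / (1 / 2) + B * (R + R) / (1 / 2) := by
      gcongr <;> linarith
    _ = 4 * R * (M + B) := by ring
    _ ≤ 4 * ((x₀ + 1) * P ^ 2) * (C * (2 * x₀ + 3) ^ m * P ^ (2 * m) + B * P ^ (2 * m)) := by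
      gcongr
    _ = _ := by ring

/-- A holomorphic function of polynomial growth on the right half plane which decays on the real
axis faster than every exponential vanishes. -/
theorem eq_zero_of_norm_le_pow_of_superexponential_decay {H : ℂ → ℂ}
    (hH : DifferentiableOn ℂ H {w | 0 < w.re}) {C B c : ℝ} {N : ℕ}
    (hgrowth : ∀ w : ℂ, 1 ≤ w.re → ‖H w‖ ≤ C * (1 + ‖w‖) ^ N) (hc : 0 < c)
    (hreal : ∀ᶠ x : ℝ in atTop, ‖H x‖ ≤ B * Real.exp (-(c * (x * Real.log x)))) :
    ∀ w : ℂ, 1 ≤ w.re → H w = 0 := by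
  -- The shift by 1 moves to where the growth bound holds. As `1 + ‖1 + v‖ ≤ 2 * ‖2 + v‖`, the
  -- quotient is bounded.
  set F : ℂ → ℂ := fun v => H (1 + v) / (2 + v) ^ N with hF
  have hne : ∀ v : ℂ, 0 ≤ v.re → (2 + v) ^ N ≠ 0 := fun v hv => pow_ne_zero _ fun h => by
    have := congrArg Complex.re h
    simp at this
    linarith
  have hC : 0 ≤ C := by
    have h := (norm_nonneg _).trans (hgrowth 1 (by simp))
    by_contra! hneg
    have : C * (1 + ‖(1 : ℂ)‖) ^ N < 0 := mul_neg_of_neg_of_pos hneg (by positivity)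
    linarith
  have hbound : ∀ v : ℂ, 0 ≤ v.re → ‖F v‖ ≤ C * 2 ^ N := by
    intro v hv
    have h1 : 2 ≤ ‖2 + v‖ := by
      refine le_trans ?_ (Complex.re_le_norm _); simp [hv]
    have h2 : ‖v‖ ≤ ‖2 + v‖ := by
      refine le_of_sq_le_sq ?_ (norm_nonneg _)
      rw [← Complex.normSq_eq_norm_sq, ← Complex.normSq_eq_norm_sq, Complex.normSq_apply,
        Complex.normSq_apply]
      simp
      nlinarith
    have h3 : 1 + ‖1 + v‖ ≤ 2 * ‖2 + v‖ := by
      have := norm_add_le 1 v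
      rw [norm_one] at this
      linarith
    rw [hF]
    simp only [norm_div, norm_pow]
    rw [div_le_iff₀ (by positivity), mul_assoc, ← mul_pow]
    refine (hgrowth _ (by simp [hv])).trans ?_
    gcongr
  have hzero : Set.EqOn F 0 {z : ℂ | 0 ≤ z.re} := by
    refine PhragmenLindelof.eq_zero_on_right_half_plane_of_superexponential_decay ?_
      ⟨0, by norm_num, 0, ?_⟩ ?_ ⟨C * 2 ^ N, fun x => hbound _ (by simp)⟩
    · refine DifferentiableOn.diffContOnCl ?_
      have hcl : closure {z : ℂ | 0 < z.re} ⊆ {z | 0 ≤ z.re} :=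
        closure_minimal (fun z (hz : 0 < z.re) => hz.le) (isClosed_le continuous_const Complex.continuous_re)
      refine DifferentiableOn.mono ?_ hcl
      refine DifferentiableOn.div (hH.comp (by fun_prop) fun v hv => ?_) (by fun_prop) hne
      simp only [Set.mem_ofPred_eq] at hv
      simp only [Set.mem_ofPred_eq, Complex.add_re, Complex.one_re]
      linarith
    · refine Asymptotics.IsBigO.of_bound (C * 2 ^ N) ?_
      filter_upwards [mem_inf_of_right (mem_principal_self _)] with v (hv : 0 < v.re)
      simpa using hbound v hv.le
    · intro n
      have hlim : Tendsto (fun x : ℝ => B * Real.exp (-x)) atTop (nhds 0) := by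
        simpa using (Real.tendsto_exp_neg_atTop_nhds_zero).const_mul B
      refine squeeze_zero' (Eventually.of_forall fun x => by positivity) ?_ hlim
      have hreal' := (tendsto_atTop_add_const_left atTop (1 : ℝ) tendsto_id).eventually hreal
      -- Once `c * log (1 + x) ≥ n + 1`, the decay absorbs `exp (n * x)` and leaves `exp (-x)`.
      have hlog := (Real.tendsto_log_atTop.comp
        (tendsto_atTop_add_const_left atTop (1 : ℝ) tendsto_id)).eventually_ge_atTop ((n + 1) / c)
      filter_upwards [hreal', hlog, eventually_ge_atTop 0] with x h1 h2 hx
      simp only [id, Function.comp_apply] at h1 h2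
      rw [div_le_iff₀ hc] at h2
      have hB : 0 ≤ B := by
        by_contra! hneg
        have := mul_neg_of_neg_of_pos hneg (Real.exp_pos (-(c * ((1 + x) * Real.log (1 + x)))))
        linarith [norm_nonneg (H ((1 + x : ℝ) : ℂ))]
      have hFx : ‖F x‖ ≤ ‖H ((1 + x : ℝ) : ℂ)‖ := by
        rw [hF]
        simp only [norm_div, norm_pow]
        push_cast
        refine div_le_self (norm_nonneg _) (one_le_pow₀ ?_)
        refine le_trans ?_ (Complex.re_le_norm _)
        simp; linarith
      calc Real.exp x ^ n * ‖F x‖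
          ≤ Real.exp x ^ n * (B * Real.exp (-(c * ((1 + x) * Real.log (1 + x))))) := by
            gcongr; exact hFx.trans h1
        _ = B * Real.exp (n * x + -(c * ((1 + x) * Real.log (1 + x)))) := by
            rw [Real.exp_add, Real.exp_nat_mul]; ring
        _ ≤ B * Real.exp (-x) := by
            gcongr
            nlinarith
  intro w hw
  have h := hzero (x := w - 1) (by simpa using hw)
  simp only [hF, Pi.zero_apply, add_sub_cancel] at h
  exact (div_eq_zero_iff.1 h).resolve_right (hne _ (by simpa using hw))

/-- A zero-free holomorphic function of finite order on the right half plane which tends to `1` on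
the real axis faster than every exponential is constant. -/
theorem eq_one_of_superexponential_decay {G : ℂ → ℂ} (hG : DifferentiableOn ℂ G {w | 0 < w.re})
    (hne : ∀ w : ℂ, 0 < w.re → G w ≠ 0) {C B c : ℝ} {m : ℕ} (hC : 0 < C)
    (hgrowth : ∀ w : ℂ, 0 < w.re → Real.log ‖G w‖ ≤ C * (1 + ‖w‖) ^ m) (hc : 0 < c)
    (hreal : ∀ᶠ x : ℝ in atTop, ‖G x - 1‖ ≤ B * Real.exp (-(c * (x * Real.log x)))) :
    ∀ w : ℂ, 1 ≤ w.re → G w = 1 := by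
  have hlim : Tendsto (fun x : ℝ => B * Real.exp (-(c * (x * Real.log x)))) atTop (nhds 0) := by
    have h1 : Tendsto (fun x : ℝ => c * (x * Real.log x)) atTop atTop :=
      (tendsto_id.atTop_mul_atTop₀ Real.tendsto_log_atTop).const_mul_atTop hc
    simpa using (Real.tendsto_exp_neg_atTop_nhds_zero.comp h1).const_mul B
  obtain ⟨x₁, hx₁⟩ := eventually_atTop.1
    (hreal.and (hlim.eventually_lt_const (show (0 : ℝ) < 1 / 2 by norm_num)))
  set x₀ := max x₁ 1 with hx₀
  have hx₀1 : 1 ≤ x₀ := le_max_right _ _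
  have hhalf : ∀ x : ℝ, x₀ < x → ‖G x - 1‖ ≤ 1 / 2 := fun x hx =>
    have h := hx₁ x ((le_max_left _ _).trans hx.le)
    h.1.trans h.2.le
  have hslit : ∀ x : ℝ, x₀ < x → G x ∈ Complex.slitPlane := fun x hx => by
    have := Complex.mem_slitPlane_of_norm_lt_one ((hhalf x hx).trans_lt (by norm_num))
    simpa using this
  -- The branch matters: only the principal one inherits the decay of `G - 1`; others tend to a
  -- nonzero multiple of `2πi`.
  obtain ⟨H, hHd, hHe, hHlog⟩ :=
    exists_log_eq_principal_of_re_pos hG hne (by linarith) hslit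
  have hlogle : ∀ x : ℝ, x₀ < x → ‖H x‖ ≤ 3 / 2 * ‖G x - 1‖ := fun x hx => by
    rw [hHlog x hx]
    have := Complex.norm_log_one_add_half_le_self (hhalf x hx)
    simpa using this
  have hre : ∀ w : ℂ, 0 < w.re → (H w).re ≤ C * (1 + ‖w‖) ^ m := fun w hw => by
    have := hgrowth w hw
    rwa [← hHe w hw, Complex.norm_exp, Real.log_exp] at this
  obtain ⟨C', hC'⟩ := norm_le_pow_of_re_le_pow hHd (B := 1) (x₀ := x₀) hC (by norm_num)
    (by linarith) hre fun x hx => (hlogle x hx).trans (by linarith [hhalf x hx])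
  have hz := eq_zero_of_norm_le_pow_of_superexponential_decay hHd hC' hc (B := 3 / 2 * B) (by
    filter_upwards [eventually_gt_atTop x₀, hreal] with x hx h
    refine (hlogle x hx).trans ?_
    linarith)
  intro w hw
  rw [← hHe w (by linarith), hz w hw, Complex.exp_zero]

/-! ### Geometry of the cone and of `v log v` -/

/-- A left cone stays away from the imaginary direction. -/
theorem exists_re_le_neg_mul_abs_im_of_mem_openCone {θ₁ θ₂ : ℝ} (h₁ : Real.pi / 2 < θ₁)
    (h₂ : θ₂ < 3 * Real.pi / 2) :
    ∃ τ : ℝ, 0 < τ ∧ ∀ z ∈ openCone θ₁ θ₂, z.re ≤ -(τ * |z.im|) := by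
  by_cases h₁₂ : θ₁ ≤ θ₂
  swap
  · refine ⟨1, one_pos, ?_⟩
    rintro z ⟨r, θ, -, h3, h4, -⟩
    linarith
  obtain ⟨θ₀, hθ₀, hmax⟩ := (isCompact_Icc (a := θ₁) (b := θ₂)).exists_isMaxOn
    (Set.nonempty_Icc.2 h₁₂) Real.continuous_cos.continuousOn
  have hneg : Real.cos θ₀ < 0 :=
    Real.cos_neg_of_pi_div_two_lt_of_lt (by linarith [hθ₀.1]) (by linarith [hθ₀.2])
  refine ⟨-Real.cos θ₀, by linarith, ?_⟩
  rintro z ⟨r, θ, hr, h3, h4, rfl⟩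
  have hcos : Real.cos θ ≤ Real.cos θ₀ := hmax ⟨h3.le, h4.le⟩
  have hre : ((r : ℂ) * Complex.exp (θ * Complex.I)).re = r * Real.cos θ := by
    rw [Complex.re_ofReal_mul, Complex.exp_ofReal_mul_I_re]
  have him : ((r : ℂ) * Complex.exp (θ * Complex.I)).im = r * Real.sin θ := by
    rw [Complex.im_ofReal_mul, Complex.exp_ofReal_mul_I_im]
  rw [hre, him, abs_mul, abs_of_pos hr]
  have hs := Real.abs_sin_le_one θ
  nlinarith [mul_le_mul_of_nonneg_left hcos hr.le,
    mul_le_mul_of_nonneg_left (mul_le_mul_of_nonneg_left hs (neg_nonneg.2 hneg.le)) hr.le]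

/-- The map `v ↦ v log v` takes a right half plane far out into a sector larger than the right
half plane. -/
theorem neg_mul_abs_im_le_re_mul_log {τ : ℝ} (hτ : 0 < τ) {v : ℂ} (hre : 0 < v.re)
    (hlog : Real.pi / 2 ≤ τ * Real.log ‖v‖) :
    -(τ * |(v * Complex.log v).im|) ≤ (v * Complex.log v).re := by
  set L := Real.log ‖v‖ with hL
  have hL0 : 0 ≤ L := by
    by_contra! h
    have := mul_neg_of_pos_of_neg hτ h
    linarith [Real.pi_pos]
  have harg := Complex.abs_arg_le_pi_div_two_iff.2 hre.le
  -- As `arg v` has the sign of `v.im`, the two terms of the imaginary part do not cancel, so it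
  -- dominates `|v.im| * L`. The loss `|v.im * arg v|` in the real part is at most `τ * |v.im| * L`.
  rw [Complex.mul_im, Complex.mul_re, Complex.log_re, Complex.log_im, ← hL]
  have hreL : 0 ≤ v.re * L := by positivity
  rcases le_or_gt 0 v.im with him | him
  · have h0 : 0 ≤ v.arg := Complex.arg_nonneg_iff.2 him
    rw [abs_of_nonneg h0] at harg
    rw [abs_of_nonneg (by positivity)]
    nlinarith [mul_le_mul_of_nonneg_left (harg.trans hlog) him,
      mul_nonneg hτ.le (mul_nonneg hre.le h0)]
  · have h0 : v.arg < 0 := Complex.arg_neg_iff.2 him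
    rw [abs_of_neg h0] at harg
    have hsum : v.re * v.arg + v.im * L ≤ 0 := by
      nlinarith [mul_pos hre (neg_pos.2 h0), mul_nonneg (neg_nonneg.2 him.le) hL0]
    rw [abs_of_nonpos hsum]
    nlinarith [mul_le_mul_of_nonneg_left (harg.trans hlog) (neg_nonneg.2 him.le),
      mul_nonneg hτ.le (mul_nonneg hre.le (neg_nonneg.2 h0.le))]

/-- A right half plane is mapped by `w ↦ β + (K + w) log (K + w)` into the set of points far from
a left cone with apex `α`, for suitable `β` and `K`. -/
theorem exists_mul_log_map_far_from_cone (α : ℂ) {τ : ℝ} (hτ : 0 < τ) (R : ℝ) :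
    ∃ (β : ℂ) (K C : ℝ), 1 ≤ K ∧ 0 < C ∧ ∀ w : ℂ, 0 < w.re →
      R ≤ ‖β + (K + w) * Complex.log (K + w)‖ ∧
      ‖β + (K + w) * Complex.log (K + w)‖ + 1 ≤ C * (1 + ‖w‖) ^ 2 ∧
      ∀ u ∈ Metric.ball (β + (K + w) * Complex.log (K + w)) 1,
        -(τ * |(u - α).im|) < (u - α).re := by
  -- Moving within a unit ball costs less than 1 in the real part and at most `τ` in the term `τ *
  -- |im|`; `β` compensates for both. The three entries of `K` ensure `log ‖v‖ ≥ 1`, the angle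
  -- condition and modulus at least `R`.
  set β : ℂ := α + (1 + τ : ℝ) with hβ
  set K : ℝ := max (Real.exp 1) (max (Real.exp (Real.pi / 2 / τ)) (‖β‖ + R)) with hK
  have hK1 : Real.exp 1 ≤ K := le_max_left _ _
  have hK2 : Real.exp (Real.pi / 2 / τ) ≤ K := (le_max_left _ _).trans (le_max_right _ _)
  have hK3 : ‖β‖ + R ≤ K := (le_max_right _ _).trans (le_max_right _ _)
  have hK0 : 1 ≤ K := (Real.one_le_exp zero_le_one).trans hK1
  have hKpos : 0 < K := by linarith
  refine ⟨β, K, ‖β‖ + 1 + K * (K + 2), hK0, by positivity, fun w hw => ?_⟩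
  set v : ℂ := K + w with hv
  have hvre : K < v.re := by simp [hv, hw]
  have hvK : K ≤ ‖v‖ := hvre.le.trans (Complex.re_le_norm v)
  have hv0 : 0 < v.re := by linarith
  have hlog1 : 1 ≤ Real.log ‖v‖ := by
    rw [Real.le_log_iff_exp_le (by linarith)]; exact hK1.trans hvK
  have hlogτ : Real.pi / 2 ≤ τ * Real.log ‖v‖ := by
    rw [mul_comm, ← div_le_iff₀ hτ, Real.le_log_iff_exp_le (by linarith)]
    exact hK2.trans hvK
  have hlogle : Real.log ‖v‖ ≤ ‖Complex.log v‖ := by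
    rw [← Complex.log_re]; exact Complex.re_le_norm _
  have hlogge : ‖Complex.log v‖ ≤ ‖v‖ + 2 := by
    refine (Complex.norm_le_abs_re_add_abs_im _).trans ?_
    rw [Complex.log_re, Complex.log_im, abs_of_nonneg (by linarith)]
    have := Complex.abs_arg_le_pi_div_two_iff.2 hv0.le
    have := Real.log_le_sub_one_of_pos (show 0 < ‖v‖ by linarith)
    linarith [Real.pi_le_four]
  have hvw : ‖v‖ ≤ K * (1 + ‖w‖) := by
    refine (norm_add_le _ _).trans ?_
    rw [Complex.norm_real, Real.norm_of_nonneg (by linarith)]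
    nlinarith [norm_nonneg w]
  refine ⟨?_, ?_, fun u hu => ?_⟩
  · have h1 : ‖v‖ ≤ ‖v * Complex.log v‖ := by
      rw [norm_mul]; exact le_mul_of_one_le_right (norm_nonneg _) (hlog1.trans hlogle)
    have h2 := norm_sub_le (β + v * Complex.log v) β
    rw [add_sub_cancel_left] at h2
    linarith
  · have h1 : ‖v * Complex.log v‖ ≤ (K * (1 + ‖w‖)) * (K * (1 + ‖w‖) + 2) := by
      rw [norm_mul]
      gcongr
      linarith
    have h2 := norm_add_le β (v * Complex.log v)
    have hw0 := norm_nonneg w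
    have hP : 1 ≤ (1 + ‖w‖) ^ 2 := one_le_pow₀ (by linarith)
    nlinarith [mul_le_mul_of_nonneg_left hP (show 0 ≤ ‖β‖ + 1 by positivity),
      mul_nonneg hKpos.le hw0, mul_nonneg hKpos.le (mul_nonneg hw0 hw0)]
  · have hz := neg_mul_abs_im_le_re_mul_log hτ hv0 hlogτ
    set z := v * Complex.log v with hzdef
    rw [Metric.mem_ball, dist_eq_norm] at hu
    have hre := (abs_le.1 ((Complex.abs_re_le_norm _).trans hu.le)).1
    have hre' := (abs_lt.1 ((Complex.abs_re_le_norm _).trans_lt hu)).1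
    have him := (Complex.abs_im_le_norm _).trans hu.le
    have him2 : |z.im| ≤ |(u - α).im| + 1 := by
      have h3 : z.im = (u - α).im - (u - (β + z)).im := by
        simp [hβ]
      rw [h3]
      exact (abs_sub _ _).trans (by linarith)
    have h4 : (u - (β + z)).re = (u - α).re - (1 + τ) - z.re := by
      simp [hβ]; ring
    rw [h4] at hre'
    nlinarith [mul_le_mul_of_nonneg_left him2 hτ.le]

/-! ### Decay of the Dirichlet series -/

section DirichletSeries

variable {a : ℕ → ℂ} {l : ℕ → ℝ} {σ : ℝ}

/-- The smallest exponent governs the decay: `l 0 ≤ l n` lets one factor be extracted uniformly in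
`n`. -/
theorem norm_dirichlet_term_le (hl : StrictMono l) (n : ℕ) {s : ℂ}
    (hs : σ ≤ s.re) :
    ‖a n * Complex.exp (-((l n : ℂ) * s))‖ ≤
      ‖a n‖ * Real.exp (-(l n * σ)) * Real.exp (-(l 0 * (s.re - σ))) := by
  have hln : l 0 ≤ l n := hl.monotone (Nat.zero_le n)
  rw [norm_mul, Complex.norm_exp, mul_assoc, ← Real.exp_add]
  gcongr
  simp only [Complex.neg_re, Complex.re_ofReal_mul]
  nlinarith [mul_le_mul_of_nonneg_right hln (sub_nonneg.2 hs)]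

theorem differentiableOn_dirichlet_series (hl0 : 0 < l 0) (hl : StrictMono l)
    (ha : Summable fun n => ‖a n‖ * Real.exp (-(l n * σ))) :
    DifferentiableOn ℂ (fun s => 1 + ∑' n, a n * Complex.exp (-((l n : ℂ) * s)))
      {s | σ < s.re} := by
  refine (differentiableOn_const _).add (Complex.differentiableOn_tsum_of_summable_norm ha
    (fun n => by fun_prop) (isOpen_lt continuous_const Complex.continuous_re) fun n s hs => ?_)
  have hs' : σ < s.re := hs
  refine (norm_dirichlet_term_le hl n hs'.le).trans (mul_le_of_le_one_right (by positivity) ?_)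
  rw [Real.exp_le_one_iff]
  nlinarith

theorem norm_dirichlet_series_le (hl : StrictMono l)
    (ha : Summable fun n => ‖a n‖ * Real.exp (-(l n * σ))) {s : ℂ} (hs : σ ≤ s.re) :
    ‖∑' n, a n * Complex.exp (-((l n : ℂ) * s))‖ ≤
      (∑' n, ‖a n‖ * Real.exp (-(l n * σ))) * Real.exp (-(l 0 * (s.re - σ))) := by
  rw [← tsum_mul_right]
  exact tsum_of_norm_bounded (ha.mul_right _).hasSum fun n => norm_dirichlet_term_le hl n hs

end DirichletSeries

/-! ### Finite order, normal form and conclusion -/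

/-- The proximity function of a meromorphic function of finite order grows at most polynomially. -/
theorem HasFiniteOrder.exists_proximity_le {f : ℂ → ℂ} (hf : HasFiniteOrder f) :
    ∃ (k : ℕ) (C r₀ : ℝ), 0 < C ∧ 1 ≤ r₀ ∧
      ∀ r, r₀ ≤ r → ValueDistribution.proximity f ⊤ r ≤ C * r ^ k := by
  obtain ⟨k, hk⟩ := hf
  obtain ⟨C, hC, hb⟩ := hk.exists_pos
  obtain ⟨r₁, hr₁⟩ := eventually_atTop.1 hb.bound
  refine ⟨k, C, max r₁ 1, hC, le_max_right _ _, fun r hr => ?_⟩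
  have hr1 : 1 ≤ r := (le_max_right _ _).trans hr
  have h := hr₁ r ((le_max_left _ _).trans hr)
  rw [Real.norm_of_nonneg (ValueDistribution.characteristic_nonneg hr1),
    Real.norm_of_nonneg (by positivity)] at h
  have h2 : 0 ≤ ValueDistribution.logCounting f ⊤ r := ValueDistribution.logCounting_nonneg hr1
  simp only [ValueDistribution.characteristic, Pi.add_apply] at h
  linarith

/-- The normal form of a meromorphic function is analytic and nonzero off the divisor. -/
theorem analyticAt_and_ne_zero_of_notMem_support_divisor {f : ℂ → ℂ} (hf : Meromorphic f)
    (htop : ∀ z, meromorphicOrderAt f z ≠ ⊤) {u : ℂ}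
    (hu : u ∉ (MeromorphicOn.divisor f Set.univ).support) :
    AnalyticAt ℂ (toMeromorphicNFOn f Set.univ) u ∧ toMeromorphicNFOn f Set.univ u ≠ 0 := by
  have hfU : MeromorphicOn f Set.univ := fun z _ => hf z
  have hNF := meromorphicNFOn_toMeromorphicNFOn f Set.univ (Set.mem_univ u)
  have h0 : meromorphicOrderAt f u = 0 := by
    rw [Function.mem_support, not_not, MeromorphicOn.divisor_apply hfU (Set.mem_univ u)] at hu
    rcases WithTop.untop₀_eq_zero.1 hu with h | h
    · exact h
    · exact absurd h (htop u)
  rw [← meromorphicOrderAt_toMeromorphicNFOn hfU (Set.mem_univ u)] at h0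
  exact ⟨hNF.meromorphicOrderAt_nonneg_iff_analyticAt.1 h0.ge,
    hNF.meromorphicOrderAt_eq_zero_iff.1 h0⟩

theorem mainTheorem10 (f : ℂ → ℂ) (hf : IsMeromorphicDirichletSeries f)
    (α : ℂ) (θ₁ θ₂ : ℝ) (h₁ : Real.pi / 2 < θ₁) (h₁₂ : θ₁ < θ₂) (h₂ : θ₂ < 3 * Real.pi / 2) :
    ¬ ((MeromorphicOn.divisor f Set.univ).support ⊆ {ρ : ℂ | ρ - α ∈ openCone θ₁ θ₂}) := by
  intro hsub
  obtain ⟨hmer, hord, a, l, σ, hl0, hl, -, ha, hfs, s₁, s₂, hs₁, hs₂, hne⟩ := hf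
  have hfU : MeromorphicOn f Set.univ := fun z _ => hmer z
  have hUopen : IsOpen {s : ℂ | σ < s.re} := isOpen_lt continuous_const Complex.continuous_re
  have hfan : AnalyticOnNhd ℂ f {s | σ < s.re} :=
    ((differentiableOn_dirichlet_series hl0 hl ha).congr hfs).analyticOnNhd hUopen
  have htop : ∀ z, meromorphicOrderAt f z ≠ ⊤ := by
    obtain ⟨s, hs, hs0⟩ : ∃ s : ℂ, σ < s.re ∧ f s ≠ 0 := by
      by_contra! h
      exact hne ((h s₁ hs₁).trans (h s₂ hs₂).symm)
    refine hmer.exists_meromorphicOrderAt_ne_top_iff_forall.1 ⟨s, ?_⟩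
    rw [(hfan s hs).meromorphicNFAt.meromorphicOrderAt_eq_zero_iff.2 hs0]
    exact WithTop.zero_ne_top
  -- The divisor ignores the values of `f` at isolated points, so these are corrected; the half
  -- plane of convergence and the proximity function at positive radii are unaffected.
  set g := toMeromorphicNFOn f Set.univ with hg
  have hgmer : Meromorphic g := fun z =>
    (meromorphicNFOn_toMeromorphicNFOn f Set.univ (Set.mem_univ z)).meromorphicAt
  have hgf : ∀ s : ℂ, σ < s.re → g s = f s := fun s hs => by
    rw [hg, toMeromorphicNFOn_eq_toMeromorphicNFAt hfU (Set.mem_univ s),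
      toMeromorphicNFAt_eq_self.2 (hfan s hs).meromorphicNFAt]
  obtain ⟨k, C₀, r₀, hC₀, hr₀, hprox⟩ := hord.exists_proximity_le
  have hproxg : ∀ r, r₀ ≤ r → ValueDistribution.proximity g ⊤ r ≤ C₀ * r ^ k := fun r hr => by
    rw [← ValueDistribution.proximity_congr_codiscrete
      (toMeromorphicNFOn_eqOn_codiscrete hfU) (by linarith)]
    exact hprox r hr
  obtain ⟨τ, hτ, hcone⟩ := exists_re_le_neg_mul_abs_im_of_mem_openCone h₁ h₂
  -- With `r₀ + 1`, every circle about 0 meeting the unit disc around `ψ w` has radius above `r₀`.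
  obtain ⟨β, K, C, hK, hC, hψ⟩ := exists_mul_log_map_far_from_cone α hτ (r₀ + 1)
  set ψ : ℂ → ℂ := fun w => β + (K + w) * Complex.log (K + w) with hψdef
  have hreg : ∀ w : ℂ, 0 < w.re → ∀ u ∈ Metric.ball (ψ w) 1, AnalyticAt ℂ g u ∧ g u ≠ 0 :=
    fun w hw u hu => analyticAt_and_ne_zero_of_notMem_support_divisor hmer htop fun h =>
      absurd (hcone _ (hsub h)) (not_le.2 ((hψ w hw).2.2 u hu))
  have hself : ∀ w : ℂ, ψ w ∈ Metric.ball (ψ w) 1 := fun w => Metric.mem_ball_self one_pos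
  have hψd : ∀ w : ℂ, 0 < w.re → HasDerivAt ψ (Complex.log (K + w) + 1) w := fun w hw => by
    have hslit : (K : ℂ) + w ∈ Complex.slitPlane := Or.inl (by simp; linarith)
    have h1 : HasDerivAt (fun w : ℂ => (K : ℂ) + w) 1 w := (hasDerivAt_id w).const_add _
    convert! (h1.mul (h1.clog hslit)).const_add β using 1
    field_simp [Complex.slitPlane_ne_zero hslit]
  have hψre : ∀ x : ℝ, 1 ≤ x → (ψ x).re = β.re + (K + x) * Real.log (K + x) := fun x hx => by
    simp only [hψdef]
    rw [← Complex.ofReal_add, ← Complex.ofReal_log (by linarith), ← Complex.ofReal_mul,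
      Complex.add_re, Complex.ofReal_re]
  have hxlog : ∀ x : ℝ, 1 ≤ x → β.re + x * Real.log x ≤ (ψ x).re := fun x hx => by
    rw [hψre x hx]
    have := Real.log_nonneg hx
    gcongr <;> linarith
  have hfar : ∀ᶠ x : ℝ in atTop, σ < (ψ x).re := by
    have h1 : Tendsto (fun x : ℝ => β.re + x * Real.log x) atTop atTop :=
      tendsto_atTop_add_const_left _ _ (tendsto_id.atTop_mul_atTop₀ Real.tendsto_log_atTop)
    filter_upwards [h1.eventually_gt_atTop σ, eventually_ge_atTop 1] with x hx hx1
    exact hx.trans_le (hxlog x hx1)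
  have hone : ∀ w : ℂ, 1 ≤ w.re → g (ψ w) = 1 := by
    set A := ∑' n, ‖a n‖ * Real.exp (-(l n * σ)) with hA
    have hA0 : 0 ≤ A := tsum_nonneg fun n => by positivity
    -- The exponent is `k` from the proximity bound plus 1 from the factor `‖ψ w‖ + 1`, doubled
    -- since `ψ` grows at most quadratically.
    refine eq_one_of_superexponential_decay (G := fun w => g (ψ w))
      (C := 8 * C₀ * C ^ (k + 1)) (m := 2 * (k + 1)) (B := A * Real.exp (-(l 0 * (β.re - σ))))
      (c := l 0) (fun w hw => ?_) (fun w hw => (hreg w hw _ (hself w)).2) (by positivity)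
      (fun w hw => ?_) hl0 ?_
    · exact ((hreg w hw _ (hself w)).1.differentiableAt.comp w
        (hψd w hw).differentiableAt).differentiableWithinAt
    · obtain ⟨hR, hCw, -⟩ := hψ w hw
      refine (log_norm_le_of_proximity_le hgmer (M := C₀ * (‖ψ w‖ + 1) ^ k) (by linarith)
        (fun u hu => (hreg w hw u hu).1) (fun u hu => (hreg w hw u hu).2) fun r hr1 hr2 => ?_).trans
        ?_
      · refine (hproxg r (by linarith)).trans ?_
        have : 0 ≤ r := by linarith
        gcongr
      · calc 8 * (‖ψ w‖ + 1) * (C₀ * (‖ψ w‖ + 1) ^ k) = 8 * C₀ * (‖ψ w‖ + 1) ^ (k + 1) := by ring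
          _ ≤ 8 * C₀ * (C * (1 + ‖w‖) ^ 2) ^ (k + 1) := by gcongr
          _ = _ := by rw [mul_pow, ← pow_mul, ← mul_assoc]
    · filter_upwards [hfar, eventually_ge_atTop 1] with x hx hx1
      rw [hgf _ hx, hfs _ hx, add_sub_cancel_left]
      refine (norm_dirichlet_series_le hl ha hx.le).trans ?_
      rw [mul_assoc, ← Real.exp_add]
      gcongr
      nlinarith [mul_le_mul_of_nonneg_left (hxlog x hx1) hl0.le]
  obtain ⟨x, hx, hx1⟩ := (hfar.and (eventually_gt_atTop 1)).exists
  have hx0 : 0 < (x : ℂ).re := by simp; linarith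
  have hder : Complex.log (K + x) + 1 ≠ 0 := fun h => by
    have h3 := congrArg Complex.re h
    rw [← Complex.ofReal_add, Complex.add_re, Complex.log_ofReal_re, Complex.one_re,
      Complex.zero_re] at h3
    linarith [Real.log_nonneg (show 1 ≤ K + x by linarith)]
  -- Since `ψ' x ≠ 0`, punctured neighbourhoods of `x` map into punctured neighbourhoods of `ψ x`,
  -- so `f = 1` accumulates there.
  have hfreq : ∃ᶠ s in nhdsWithin (ψ x) {ψ x}ᶜ, f s = 1 := by
    refine ((hψd x hx0).tendsto_nhdsNE hder).frequently (Eventually.frequently ?_)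
    refine eventually_nhdsWithin_of_eventually_nhds ?_
    have h1 : ∀ᶠ w : ℂ in nhds (x : ℂ), 1 < w.re :=
      Complex.continuous_re.continuousAt.eventually_const_lt (by simpa using hx1)
    have h2 : ∀ᶠ w : ℂ in nhds (x : ℂ), σ < (ψ w).re :=
      (Complex.continuous_re.continuousAt.comp
        (hψd x hx0).continuousAt).eventually_const_lt hx
    filter_upwards [h1, h2] with w hw1 hw2
    rw [← hgf _ hw2, hone w hw1.le]
  have hconst : Set.EqOn f (fun _ => 1) {s | σ < s.re} :=
    hfan.eqOn_of_preconnected_of_frequently_eq (fun _ _ => analyticAt_const)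
      (convex_halfSpace_re_gt σ).isPreconnected hx hfreq
  exact hne ((hconst hs₁).trans (hconst hs₂).symm)
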